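/- Let $(\Omega,\mathscr F,\mathbb P,\theta)$ be a stationary ergodic quadruple: $\mathbb P$ is a probability measure, $\theta$ is a bijection of $\Omega$, measurable together with its inverse, which preserves $\mathbb P$, and every $\theta$-invariant event has probability $0$ or $1$. Let $\sigma\ge 0$ and $\tau>0$ (almost surely) be integrable real random variables. Let $p\ge 1$ be an integer and let $\overline{(\mathbb R_+)^p}$ be the set of vectors $u=(u(1),\dots,u(p))$ of real numbers with $0\le u(1)\le\dots\le u(p)$, with the coordinatewise order $\prec$. For $x\in\mathbb R$ put $x^+=\max(x,0)$ (coordinatewise for vectors), and for $u\in\mathbb R^p$ let $\overline u$ be the vector $u$ with its coordinates rearranged in nondecreasing order. Define the random maps $\Psi^p$ and $H^p$ from $\overline{(\mathbb R_+)^p}$ to itself by $$\Psi^p(u)(j)=\bigl[(u(j)\vee\sigma)\wedge u(j+1)-\tau\bigr]^+\ (1\le j\le p-1),\qquad \Psi^p(u)(p)=\bigl[(u(p)\vee\sigma)-\tau\bigr]^+,$$ $$H^p(u)=\overline{\bigl[u+\sigma\mathbf 1_{\{u(1)=0\}}\mathbf e_1-\tau(1,\dots,1)\bigr]^+},$$ where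 $\mathbf e_1=(1,0,\dots,0)$. Let $Y^p$ be the minimal solution of $Y\circ\theta=\Psi^p(Y)$ a.s., that is, an $\overline{(\mathbb R_+)^p}$-valued random variable which solves this equation and satisfies $Y^p\prec Y$ a.s. for every $\overline{(\mathbb R_+)^p}$-valued solution $Y$. Suppose that $$\mathbb P\Bigl(\{Y^p(1)=0\}\cap\bigcap_{\ell=2}^{p}\Bigl\{Y^p(\ell)\le\sum_{i=0}^{\ell-2}\tau\circ\theta^i\Bigr\}\Bigr)>0 .$$ Then the equation $U\circ\theta=H^p(U)$ a.s. has an $\overline{(\mathbb R_+)^p}$-valued solution $U^p$. It is unique, up to almost sure equality, among all $\overline{(\mathbb R_+)^p}$-valued solutions, and $U^p\prec Y^p$ a.s. -/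

import Mathlib

open MeasureTheory

noncomputable section

/-- The set of nondecreasingly ordered vectors of size `p` with nonnegative real coordinates.
The coordinate written `u(i)` in one-based notation is `u ⟨i - 1, _⟩` here. -/
def orderedProfiles (p : ℕ) : Set (Fin p → ℝ) :=
  {u | Monotone u ∧ ∀ i, 0 ≤ u i}

/-- The fully ordered version of a vector (coordinates rearranged in nondecreasing order). -/
def orderedVersion {p : ℕ} (u : Fin p → ℝ) : Fin p → ℝ :=
  u ∘ Tuple.sort u

/-- The map `Ψ^p` for given values `s` of the service time and `t` of the inter-arrival time:
`v(j) = [(u(j) ∨ s) ∧ u(j+1) - t]⁺` for `j < p` and `v(p) = [(u(p) ∨ s) - t]⁺`. -/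
def psiMap {p : ℕ} (s t : ℝ) (u : Fin p → ℝ) : Fin p → ℝ := fun j =>
  if h : (j : ℕ) + 1 < p then
    max (min (max (u j) s) (u ⟨(j : ℕ) + 1, h⟩) - t) 0
  else
    max (max (u j) s - t) 0

/-- The driving map `H^p` of the loss system with `p` servers, for given values `s` of the service
time and `t` of the inter-arrival time: the ordered version of
`[u + s 1_{u(1) = 0} e₁ - t (1, …, 1)]⁺`. -/
def lossMap {p : ℕ} [NeZero p] (s t : ℝ) (u : Fin p → ℝ) : Fin p → ℝ :=
  orderedVersion fun j =>
    max (u j + (if u 0 = 0 then s else 0) * (Pi.single (0 : Fin p) (1 : ℝ) : Fin p → ℝ) j - t) 0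

/-- `X` is a random variable with values in the ordered nonnegative vectors which solves
`X ∘ θ = F(X)` almost surely, where `F` is a random map. -/
def IsStationarySolution {Ω : Type*} [MeasurableSpace Ω] (P : Measure Ω) (θ : Ω → Ω) {p : ℕ}
    (F : Ω → (Fin p → ℝ) → (Fin p → ℝ)) (X : Ω → Fin p → ℝ) : Prop :=
  Measurable X ∧ (∀ ω, X ω ∈ orderedProfiles p) ∧ ∀ᵐ ω ∂P, X (θ ω) = F ω (X ω)

/-- `X` is a solution of `X ∘ θ = F(X)` that is almost surely minimal, for the coordinatewise
ordering, among all solutions. -/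
def IsMinimalStationarySolution {Ω : Type*} [MeasurableSpace Ω] (P : Measure Ω) (θ : Ω → Ω) {p : ℕ}
    (F : Ω → (Fin p → ℝ) → (Fin p → ℝ)) (X : Ω → Fin p → ℝ) : Prop :=
  IsStationarySolution P θ F X ∧
    ∀ X' : Ω → Fin p → ℝ, IsStationarySolution P θ F X' → ∀ᵐ ω ∂P, X ω ≤ X' ω

end

/-- The number of coordinates of `u` that exceed the level `x`. -/
noncomputable def exceedCount {p : ℕ} (u : Fin p → ℝ) (x : ℝ) : ℕ :=
  ∑ j, if x < u j then 1 else 0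

theorem exceedCount_eq_card {p : ℕ} (u : Fin p → ℝ) (x : ℝ) :
    exceedCount u x = (Finset.univ.filter fun j => x < u j).card := by
  simp [exceedCount]

theorem exceedCount_orderedVersion {p : ℕ} (u : Fin p → ℝ) (x : ℝ) :
    exceedCount (orderedVersion u) x = exceedCount u x :=
  Equiv.sum_comp (Tuple.sort u) fun j => if x < u j then 1 else 0

/-- For a nondecreasing vector the level sets of each coordinate are read off from the number of
exceedances. -/
theorem Monotone.lt_apply_iff_le_exceedCount {p : ℕ} {w : Fin p → ℝ} (hw : Monotone w)
    (j : Fin p) (x : ℝ) : x < w j ↔ p ≤ exceedCount w x + j := by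
  rw [exceedCount_eq_card]
  have hj := j.2
  constructor
  · intro h
    have hs : Finset.Ici j ⊆ Finset.univ.filter fun i => x < w i := fun i hi => by
      simpa using h.trans_le (hw (Finset.mem_Ici.1 hi))
    have := Finset.card_le_card hs
    rw [Fin.card_Ici] at this
    omega
  · intro h
    by_contra! hx
    have hs : (Finset.univ.filter fun i => x < w i) ⊆ Finset.Ioi j := fun i hi => by
      rw [Finset.mem_Ioi]
      by_contra! hij
      have := (Finset.mem_filter.1 hi).2
      linarith [hw hij]
    have := Finset.card_le_card hs
    rw [Fin.card_Ioi] at this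
    omega

theorem orderedVersion_monotone {p : ℕ} (u : Fin p → ℝ) : Monotone (orderedVersion u) :=
  Tuple.monotone_sort u

theorem lt_orderedVersion_iff {p : ℕ} (u : Fin p → ℝ) (j : Fin p) (x : ℝ) :
    x < orderedVersion u j ↔ p ≤ exceedCount u x + j := by
  rw [(orderedVersion_monotone u).lt_apply_iff_le_exceedCount, exceedCount_orderedVersion]

theorem measurable_orderedVersion {p : ℕ} :
    Measurable (orderedVersion : (Fin p → ℝ) → Fin p → ℝ) := by
  refine measurable_pi_lambda _ fun j => measurable_of_Ioi fun x => ?_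
  have hm : Measurable fun u : Fin p → ℝ => exceedCount u x + (j : ℕ) := by
    refine Measurable.add_const ?_ _
    refine Finset.measurable_sum _ fun i _ => ?_
    exact Measurable.ite (measurableSet_lt measurable_const (measurable_pi_apply i))
      measurable_const measurable_const
  have : (fun u : Fin p → ℝ => orderedVersion u j) ⁻¹' Set.Ioi x =
      (fun u : Fin p → ℝ => exceedCount u x + (j : ℕ)) ⁻¹' Set.Ici p := by
    ext u
    simpa using lt_orderedVersion_iff u j x
  rw [this]
  exact hm measurableSet_Ici

theorem eq_of_exceedCount_eq {p : ℕ} {u v : Fin p → ℝ} (hu : u ∈ orderedProfiles p)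
    (hv : v ∈ orderedProfiles p) (h : ∀ x, 0 ≤ x → exceedCount u x = exceedCount v x) :
    u = v := by
  funext j
  refine le_antisymm ?_ ?_
  · by_contra! hlt
    rw [hu.1.lt_apply_iff_le_exceedCount, h _ (hv.2 j),
      ← hv.1.lt_apply_iff_le_exceedCount] at hlt
    exact lt_irrefl _ hlt
  · by_contra! hlt
    rw [hv.1.lt_apply_iff_le_exceedCount, ← h _ (hu.2 j),
      ← hu.1.lt_apply_iff_le_exceedCount] at hlt
    exact lt_irrefl _ hlt

theorem zero_mem_orderedProfiles {p : ℕ} : (0 : Fin p → ℝ) ∈ orderedProfiles p :=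
  ⟨monotone_const, fun _ => le_rfl⟩

theorem lossMap_mem_orderedProfiles {p : ℕ} [NeZero p] (s t : ℝ) (u : Fin p → ℝ) :
    lossMap s t u ∈ orderedProfiles p :=
  ⟨orderedVersion_monotone _, fun _ => le_max_right _ _⟩

theorem measurable_lossMap {Ω : Type*} [MeasurableSpace Ω] {p : ℕ} [NeZero p] {σ τ : Ω → ℝ}
    {U : Ω → Fin p → ℝ} (hσ : Measurable σ) (hτ : Measurable τ) (hU : Measurable U) :
    Measurable fun ω => lossMap (σ ω) (τ ω) (U ω) := by
  refine measurable_orderedVersion.comp (measurable_pi_lambda _ fun j => ?_)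
  have hc : ∀ i, Measurable fun ω => U ω i := fun i => (measurable_pi_apply i).comp hU
  have hite : Measurable fun ω => if U ω 0 = 0 then σ ω else 0 :=
    Measurable.ite ((hc 0) (measurableSet_singleton 0)) hσ measurable_const
  exact (((hc j).add (hite.mul_const _)).sub hτ).max measurable_const

theorem exceedCount_lossMap {p : ℕ} [NeZero p] {s t x : ℝ} {u : Fin p → ℝ} (hu : u 0 = 0)
    (ht : 0 ≤ t) (hx : 0 ≤ x) :
    exceedCount (lossMap s t u) x = exceedCount u (x + t) + if x + t < s then 1 else 0 := by
  rw [lossMap, exceedCount_orderedVersion, exceedCount, exceedCount,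
    ← Finset.add_sum_erase _ _ (Finset.mem_univ (0 : Fin p)),
    ← Finset.add_sum_erase _ (fun j => if x + t < u j then 1 else 0)
      (Finset.mem_univ (0 : Fin p))]
  have h0 : ¬ x + t < u 0 := by rw [hu]; linarith
  have h1 : (x < max (u 0 + (if u 0 = 0 then s else 0) *
      (Pi.single (0 : Fin p) (1 : ℝ) : Fin p → ℝ) 0 - t) 0) ↔ x + t < s := by
    simp [hu, hx.not_gt, lt_sub_iff_add_lt]
  rw [if_neg h0, zero_add, add_comm]
  simp only [h1]
  congr 1
  refine Finset.sum_congr rfl fun j hj => ?_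
  have hj0 : j ≠ 0 := Finset.ne_of_mem_erase hj
  simp [hj0, hx.not_gt, lt_sub_iff_add_lt]

theorem psiMap_nonneg {p : ℕ} (s t : ℝ) (u : Fin p → ℝ) (j : Fin p) : 0 ≤ psiMap s t u j := by
  unfold psiMap
  split_ifs <;> exact le_max_right _ _

theorem psiMap_mono {p : ℕ} (s t : ℝ) : Monotone (psiMap s t : (Fin p → ℝ) → Fin p → ℝ) := by
  intro u v huv j
  unfold psiMap
  split_ifs with h
  · have h1 := huv j
    have h2 := huv ⟨(j : ℕ) + 1, h⟩
    gcongr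
  · have h1 := huv j
    gcongr

theorem psiMap_le {p : ℕ} (s t : ℝ) (u : Fin p → ℝ) (j : Fin p) :
    psiMap s t u j ≤ max (max (u j) s - t) 0 := by
  unfold psiMap
  split_ifs with h
  · gcongr
    exact min_le_left _ _
  · exact le_rfl

/-- If the next coordinates are ordered and the `j`-th coordinate of `u` is at most that of `v` or
at most `s`, then the `j`-th coordinates of the images are ordered. -/
theorem psiMap_apply_le {p : ℕ} {s t : ℝ} {u v : Fin p → ℝ} {j : Fin p}
    (hnext : ∀ i, j < i → u i ≤ v i) (hj : u j ≤ max (v j) s) :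
    psiMap s t u j ≤ psiMap s t v j := by
  have h1 : max (u j) s ≤ max (v j) s := max_le hj (le_max_right _ _)
  unfold psiMap
  split_ifs with h
  · have h2 := hnext ⟨(j : ℕ) + 1, h⟩ (by rw [Fin.lt_def]; simp)
    gcongr
  · gcongr

theorem lossMap_le_psiMap {p : ℕ} [NeZero p] {s t : ℝ} {u : Fin p → ℝ}
    (hu : u ∈ orderedProfiles p) : lossMap s t u ≤ psiMap s t u := by
  intro j
  by_contra! hlt
  have hy := psiMap_nonneg s t u j
  have hjp := j.2
  rw [lossMap, lt_orderedVersion_iff, exceedCount_eq_card] at hlt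
  set y := psiMap s t u j with hydef
  set S := Finset.univ.filter fun i : Fin p => y < max (u i + (if u 0 = 0 then s else 0) *
    (Pi.single (0 : Fin p) (1 : ℝ) : Fin p → ℝ) i - t) 0 with hS
  have hmem : ∀ i ∈ S, (i = 0 ∧ u 0 = 0 ∧ y < s - t) ∨ y < u i - t := by
    intro i hi
    have h := (Finset.mem_filter.1 hi).2
    rw [lt_max_iff, or_iff_left hy.not_gt] at h
    by_cases hi0 : i = 0
    · subst hi0
      by_cases hu0 : u 0 = 0
      · left; simpa [hu0] using h
      · right; simpa [hu0] using h
    · right; simpa [hi0] using h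
  have hIoi : ∀ i, u j < u i → j < i := fun i h => by
    by_contra! hij
    linarith [hu.1 hij]
  by_cases hcase : u j - t ≤ y ∧ s - t ≤ y
  · have hs : S ⊆ Finset.Ioi j := fun i hi => by
      rw [Finset.mem_Ioi]
      rcases hmem i hi with ⟨_, _, h⟩ | h
      · linarith
      · exact hIoi i (by linarith)
    have := Finset.card_le_card hs
    rw [Fin.card_Ioi] at this
    omega
  · by_cases h : (j : ℕ) + 1 < p
    · have hyj : y = max (min (max (u j) s) (u ⟨(j : ℕ) + 1, h⟩) - t) 0 := by
        rw [hydef, psiMap, dif_pos h]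
      set k : Fin p := ⟨(j : ℕ) + 1, h⟩ with hk
      have hyk : u k - t ≤ y := by
        rcases le_total (max (u j) s) (u k) with hle | hle
        · exfalso
          rw [min_eq_left hle] at hyj
          apply hcase
          have := le_max_left (max (u j) s - t) 0
          exact ⟨by linarith [le_max_left (u j) s], by linarith [le_max_right (u j) s]⟩
        · rw [min_eq_right hle] at hyj
          rw [hyj]
          exact le_max_left _ _
      have hs : S ⊆ insert 0 (Finset.Ioi k) := fun i hi => by
        rw [Finset.mem_insert, Finset.mem_Ioi]
        rcases hmem i hi with ⟨h0, _⟩ | hlt'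
        · exact Or.inl h0
        · right
          by_contra! hik
          linarith [hu.1 hik]
      have := (Finset.card_le_card hs).trans (Finset.card_insert_le _ _)
      rw [Fin.card_Ioi] at this
      simp only [hk] at this
      omega
    · have hyj : y = max (max (u j) s - t) 0 := by
        rw [hydef, psiMap, dif_neg h]
      apply hcase
      have := le_max_left (max (u j) s - t) 0
      exact ⟨by linarith [le_max_left (u j) s], by linarith [le_max_right (u j) s]⟩

/-- The number of customers among the first `k` ones, all accepted, whose residual service time
exceeds `x` at time `k`. -/
noncomputable def acceptedCount (s t : ℕ → ℝ) : ℕ → ℝ → ℕ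
  | 0, _ => 0
  | k + 1, x => acceptedCount s t k (x + t k) + if x + t k < s k then 1 else 0

theorem acceptedCount_le (s t : ℕ → ℝ) (k : ℕ) (x : ℝ) : acceptedCount s t k x ≤ k := by
  induction k generalizing x with
  | zero => simp [acceptedCount]
  | succ k ih =>
    have := ih (x + t k)
    rw [acceptedCount]
    split_ifs <;> omega

/-- If the `j`-th smallest residual service time vanishes by time `j`, for all `j`, then the first
`p - 1` customers are accepted. -/
theorem exceedCount_lossMap_orbit {p : ℕ} [NeZero p] {s t : ℕ → ℝ} {u : ℕ → Fin p → ℝ}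
    (ht : ∀ k, 0 ≤ t k) (hu : ∀ k, u k ∈ orderedProfiles p)
    (hrec : ∀ k, u (k + 1) = lossMap (s k) (t k) (u k))
    (hinit : ∀ j : Fin p, u 0 j ≤ ∑ i ∈ Finset.range j, t i) {k : ℕ} (hk : k < p) {x : ℝ}
    (hx : 0 ≤ x) :
    exceedCount (u k) x =
      exceedCount (u 0) (x + ∑ i ∈ Finset.range k, t i) + acceptedCount s t k x := by
  induction k generalizing x with
  | zero => simp [acceptedCount]
  | succ k ih =>
    have hk' : k < p := by omega
    have hzero : u k 0 = 0 := by
      refine le_antisymm ?_ ((hu k).2 0)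
      by_contra! hlt
      rw [(hu k).1.lt_apply_iff_le_exceedCount, ih hk' le_rfl] at hlt
      have h1 := acceptedCount_le s t k 0
      have h2 : ¬ (0 + ∑ i ∈ Finset.range k, t i) < u 0 ⟨k, hk'⟩ := by
        rw [zero_add, not_lt]
        exact hinit ⟨k, hk'⟩
      rw [(hu 0).1.lt_apply_iff_le_exceedCount] at h2
      simp only [Fin.val_zero] at hlt
      simp only at h2
      omega
    rw [hrec k, exceedCount_lossMap hzero (ht k) hx, ih hk' (add_nonneg hx (ht k)),
      acceptedCount, Finset.sum_range_succ, add_assoc, add_assoc x, add_comm (t k)]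

/-- The renovation property: under the clearing condition, the state of the loss system at time
`p - 1` does not depend on the initial state. -/
theorem lossMap_orbit_coupling {p : ℕ} [NeZero p] {s t : ℕ → ℝ} {u v : ℕ → Fin p → ℝ}
    (ht : ∀ k, 0 ≤ t k) (hu : ∀ k, u k ∈ orderedProfiles p) (hv : ∀ k, v k ∈ orderedProfiles p)
    (hurec : ∀ k, u (k + 1) = lossMap (s k) (t k) (u k))
    (hvrec : ∀ k, v (k + 1) = lossMap (s k) (t k) (v k))
    (huinit : ∀ j : Fin p, u 0 j ≤ ∑ i ∈ Finset.range j, t i)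
    (hvinit : ∀ j : Fin p, v 0 j ≤ ∑ i ∈ Finset.range j, t i) :
    u (p - 1) = v (p - 1) := by
  have hp : p - 1 < p := Nat.sub_lt (NeZero.pos p) one_pos
  have key : ∀ w : Fin p → ℝ, w ∈ orderedProfiles p →
      (∀ j : Fin p, w j ≤ ∑ i ∈ Finset.range j, t i) → ∀ x, 0 ≤ x →
      exceedCount w (x + ∑ i ∈ Finset.range (p - 1), t i) = 0 := by
    intro w hw hinit x hx
    have h : ¬ (x + ∑ i ∈ Finset.range (p - 1), t i) < w ⟨p - 1, hp⟩ := by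
      rw [not_lt]
      exact (hinit ⟨p - 1, hp⟩).trans (le_add_of_nonneg_left hx)
    rw [hw.1.lt_apply_iff_le_exceedCount] at h
    simp only at h
    omega
  refine eq_of_exceedCount_eq (hu _) (hv _) fun x hx => ?_
  rw [exceedCount_lossMap_orbit ht hu hurec huinit hp hx,
    exceedCount_lossMap_orbit ht hv hvrec hvinit hp hx,
    key _ (hu 0) huinit x hx, key _ (hv 0) hvinit x hx]

section Stationary

variable {Ω : Type*} [MeasurableSpace Ω] {P : Measure Ω}

/-- A measurable function cannot decrease strictly along the orbits of a probability-preserving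
map. -/
theorem not_ae_comp_lt [IsProbabilityMeasure P] {θ : Ω → Ω} (hθ : MeasurePreserving θ P P)
    {X : Ω → ℝ} (hX : Measurable X) : ¬ ∀ᵐ ω ∂P, X (θ ω) < X ω := by
  intro h
  have hm : Measurable fun ω => Real.arctan (X ω) := Real.measurable_arctan.comp hX
  have hint : Integrable (fun ω => Real.arctan (X ω)) P := by
    refine Integrable.of_bound hm.aestronglyMeasurable (Real.pi / 2) (ae_of_all _ fun ω => ?_)
    rw [Real.norm_eq_abs, abs_le]
    exact ⟨(Real.neg_pi_div_two_lt_arctan _).le, (Real.arctan_lt_pi_div_two _).le⟩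
  have hint' : Integrable (fun ω => Real.arctan (X (θ ω))) P :=
    hθ.integrable_comp_of_integrable hint
  have heq : ∫ ω, Real.arctan (X (θ ω)) ∂P = ∫ ω, Real.arctan (X ω) ∂P := by
    conv_rhs => rw [← hθ.map_eq]
    exact (integral_map hθ.measurable.aemeasurable hm.aestronglyMeasurable).symm
  have hle : (fun ω => Real.arctan (X (θ ω))) ≤ᵐ[P] fun ω => Real.arctan (X ω) :=
    h.mono fun ω hω => (Real.arctan_strictMono hω).le
  have hae := (integral_eq_iff_of_ae_le hint' hint hle).1 heq
  obtain ⟨ω, h1, h2⟩ := (h.and hae).exists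
  exact (Real.arctan_strictMono h1).ne h2

theorem ae_forall_iterate {θ : Ω → Ω} (hθ : MeasurePreserving θ P P) {q : Ω → Prop}
    (h : ∀ᵐ ω ∂P, q ω) : ∀ᵐ ω ∂P, ∀ k : ℕ, q (θ^[k] ω) :=
  ae_all_iff.2 fun k => (hθ.iterate k).quasiMeasurePreserving.ae h

/-- A forward invariant property that holds with positive probability after a fixed number of steps
holds almost surely. -/
theorem Ergodic.ae_of_forward_invariant [IsProbabilityMeasure P] {θ : Ω → Ω}
    (hθ : Ergodic θ P) {B A : Set Ω} (hB : MeasurableSet B) (hinv : ∀ᵐ ω ∂P, ω ∈ B → θ ω ∈ B)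
    (hA : P A ≠ 0) {n : ℕ} (hAB : ∀ᵐ ω ∂P, ω ∈ A → θ^[n] ω ∈ B) : ∀ᵐ ω ∂P, ω ∈ B := by
  rcases hθ.ae_empty_or_univ_of_ae_le_preimage hB.nullMeasurableSet hinv with h | h
  · exfalso
    have h1 : P A ≤ P (θ^[n] ⁻¹' B) := measure_mono_ae hAB
    rw [(hθ.toMeasurePreserving.iterate n).measure_preimage hB.nullMeasurableSet,
      measure_congr h, measure_empty] at h1
    exact hA (le_antisymm h1 bot_le)
  · filter_upwards [h] with ω hω
    exact hω.mpr trivial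

/-- Every stationary solution for the loss map is dominated by every stationary solution for
`psiMap`. -/
theorem IsStationarySolution.loss_le_psi [IsProbabilityMeasure P] {θ : Ω → Ω}
    (hθ : Ergodic θ P) {σ τ : Ω → ℝ} (hτ_pos : ∀ᵐ ω ∂P, 0 < τ ω) {p : ℕ} [NeZero p]
    {U Y : Ω → Fin p → ℝ}
    (hU : IsStationarySolution P θ (fun ω => lossMap (σ ω) (τ ω)) U)
    (hY : IsStationarySolution P θ (fun ω => psiMap (σ ω) (τ ω)) Y) :
    ∀ᵐ ω ∂P, U ω ≤ Y ω := by
  suffices h : ∀ j : Fin p, ∀ᵐ ω ∂P, U ω j ≤ Y ω j from ae_all_iff.2 h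
  intro j
  induction hn : p - (j : ℕ) using Nat.strong_induction_on generalizing j with
  | _ n ih =>
    have hnext : ∀ᵐ ω ∂P, ∀ i, j < i → U ω i ≤ Y ω i := by
      refine ae_all_iff.2 fun i => ?_
      by_cases hij : j < i
      · have := j.2
        filter_upwards [ih (p - i) (by rw [Fin.lt_def] at hij; omega) i rfl] with ω h _ using h
      · exact ae_of_all _ fun ω h => absurd h hij
    have hUm : Measurable fun ω => U ω j := (measurable_pi_apply j).comp hU.1
    have hYm : Measurable fun ω => Y ω j := (measurable_pi_apply j).comp hY.1
    have hstep : ∀ᵐ ω ∂P, U (θ ω) j ≤ psiMap (σ ω) (τ ω) (U ω) j := by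
      filter_upwards [hU.2.2] with ω h
      rw [h]
      exact lossMap_le_psiMap (hU.2.1 ω) j
    have hkeep : ∀ᵐ ω ∂P, U ω j ≤ max (Y ω j) (σ ω) → U (θ ω) j ≤ Y (θ ω) j := by
      filter_upwards [hstep, hnext, hY.2.2] with ω h1 h2 h3 h4
      rw [h3]
      exact h1.trans (psiMap_apply_le h2 h4)
    have hBm : MeasurableSet {ω | U ω j ≤ Y ω j} := measurableSet_le hUm hYm
    have hinv : ∀ᵐ ω ∂P, ω ∈ {ω | U ω j ≤ Y ω j} → θ ω ∈ {ω | U ω j ≤ Y ω j} := by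
      filter_upwards [hkeep] with ω h hω
      exact h (le_max_of_le_left hω)
    by_cases hzero : P {ω | U ω j ≤ Y ω j} = 0
    · exfalso
      have hgt : ∀ᵐ ω ∂P, Y ω j < U ω j := by
        filter_upwards [measure_eq_zero_iff_ae_notMem.1 hzero] with ω hω
        exact not_le.1 hω
      refine not_ae_comp_lt hθ.toMeasurePreserving hUm ?_
      filter_upwards [hstep, hkeep, hτ_pos,
        hθ.toMeasurePreserving.quasiMeasurePreserving.ae hgt] with ω h1 h2 h3 h4
      have h5 : σ ω < U ω j := by
        by_contra! hle
        exact (h2 (le_max_of_le_right hle)).not_gt h4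
      have h6 := h1.trans (psiMap_le _ _ _ _)
      rw [max_eq_left h5.le] at h6
      rcases le_max_iff.1 h6 with h7 | h7
      · linarith
      · linarith [hY.2.1 (θ ω) |>.2 j]
    · exact hθ.ae_of_forward_invariant hBm hinv hzero (n := 0) (ae_of_all _ fun ω h => h)

/-- The state at time `0` of the loss system that is empty `n` steps in the past. -/
noncomputable def loynesIterate (θ : Ω ≃ᵐ Ω) (σ τ : Ω → ℝ) (p : ℕ) [NeZero p] : ℕ → Ω → Fin p → ℝ
  | 0, _ => 0
  | n + 1, ω => lossMap (σ (θ.symm ω)) (τ (θ.symm ω)) (loynesIterate θ σ τ p n (θ.symm ω))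

variable {θ : Ω ≃ᵐ Ω} {σ τ : Ω → ℝ} {p : ℕ} [NeZero p]

theorem loynesIterate_succ_apply (n : ℕ) (ω : Ω) :
    loynesIterate θ σ τ p (n + 1) (θ ω) = lossMap (σ ω) (τ ω) (loynesIterate θ σ τ p n ω) := by
  simp [loynesIterate]

theorem loynesIterate_mem (n : ℕ) (ω : Ω) : loynesIterate θ σ τ p n ω ∈ orderedProfiles p := by
  cases n with
  | zero => exact zero_mem_orderedProfiles
  | succ n => exact lossMap_mem_orderedProfiles _ _ _

theorem measurable_loynesIterate (hσm : Measurable σ) (hτm : Measurable τ) (n : ℕ) :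
    Measurable (loynesIterate θ σ τ p n) := by
  induction n with
  | zero => exact measurable_const
  | succ n ih =>
    exact (measurable_lossMap hσm hτm ih).comp θ.symm.measurable

theorem loynesIterate_le (hθ : MeasurePreserving θ P P) {Y : Ω → Fin p → ℝ}
    (hY : IsStationarySolution P θ (fun ω => psiMap (σ ω) (τ ω)) Y) :
    ∀ᵐ ω ∂P, ∀ n, loynesIterate θ σ τ p n ω ≤ Y ω := by
  refine ae_all_iff.2 fun n => ?_
  induction n with
  | zero => exact ae_of_all _ fun ω j => (hY.2.1 ω).2 j
  | succ n ih =>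
    have h : ∀ᵐ ω ∂P, loynesIterate θ σ τ p (n + 1) (θ ω) ≤ Y (θ ω) := by
      filter_upwards [ih, hY.2.2] with ω h1 h2
      rw [h2, loynesIterate_succ_apply]
      exact (lossMap_le_psiMap (loynesIterate_mem n ω)).trans (psiMap_mono _ _ h1)
    filter_upwards [(hθ.symm θ).quasiMeasurePreserving.ae h] with ω hω
    simpa using hω

end Stationary

theorem mainTheorem4 {Ω : Type*} [MeasurableSpace Ω] (P : Measure Ω) [IsProbabilityMeasure P]
    (θ : Ω ≃ᵐ Ω) (hθ : Ergodic θ P)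
    (σ τ : Ω → ℝ) (hσm : Measurable σ) (hτm : Measurable τ)
    (hσ : Integrable σ P) (hτ : Integrable τ P)
    (hσ_nonneg : ∀ᵐ ω ∂P, 0 ≤ σ ω) (hτ_pos : ∀ᵐ ω ∂P, 0 < τ ω)
    (p : ℕ) [NeZero p]
    (Y : Ω → Fin p → ℝ)
    (hY : IsMinimalStationarySolution P θ (fun ω => psiMap (σ ω) (τ ω)) Y)
    -- the index `j` stands for `ℓ = j + 1`, so the sum runs over `i = 0, …, ℓ - 2`
    (hH : 0 < P {ω | Y ω 0 = 0 ∧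
      ∀ j : Fin p, 0 < j → Y ω j ≤ ∑ i ∈ Finset.range (j : ℕ), τ (θ^[i] ω)}) :
    ∃ U : Ω → Fin p → ℝ,
      IsStationarySolution P θ (fun ω => lossMap (σ ω) (τ ω)) U ∧
      (∀ U' : Ω → Fin p → ℝ,
        IsStationarySolution P θ (fun ω => lossMap (σ ω) (τ ω)) U' → U' =ᵐ[P] U) ∧
      ∀ᵐ ω ∂P, U ω ≤ Y ω := by
  have hmp : MeasurePreserving θ P P := hθ.toMeasurePreserving
  set A : Set Ω := {ω | Y ω 0 = 0 ∧
      ∀ j : Fin p, 0 < j → Y ω j ≤ ∑ i ∈ Finset.range (j : ℕ), τ (θ^[i] ω)} with hAdef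
  have hA : ∀ ω ∈ A, ∀ j : Fin p, Y ω j ≤ ∑ i ∈ Finset.range (j : ℕ), τ (θ^[i] ω) := by
    intro ω hω j
    rcases (Fin.zero_le j).eq_or_lt with h | h
    · rw [← h, hω.1]
      simp
    · exact hω.2 j h
  have hτ_iter : ∀ᵐ ω ∂P, ∀ k : ℕ, 0 < τ (θ^[k] ω) := ae_forall_iterate hmp hτ_pos
  let M := loynesIterate θ σ τ p
  have hMmeas : ∀ n, Measurable (M n) := measurable_loynesIterate hσm hτm
  have hMmem : ∀ n ω, M n ω ∈ orderedProfiles p := loynesIterate_mem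
  have hMsucc : ∀ n ω, M (n + 1) (θ ω) = lossMap (σ ω) (τ ω) (M n ω) := loynesIterate_succ_apply
  have hMle : ∀ᵐ ω ∂P, ∀ n, M n ω ≤ Y ω := loynesIterate_le hmp hY.1
  -- the set where the iterates are eventually constant
  let G : Set Ω := {ω | ∃ N, ∀ n, M (N + n) ω = M N ω}
  have hGmeas : MeasurableSet G := by
    have : G = ⋃ N, ⋂ n, {ω | M (N + n) ω = M N ω} := by
      ext ω
      simp [G]
    rw [this]
    exact MeasurableSet.iUnion fun N => MeasurableSet.iInter fun n =>
      measurableSet_eq_fun (hMmeas _) (hMmeas _)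
  have hGinv : ∀ ω, ω ∈ G → θ ω ∈ G := by
    rintro ω ⟨N, hN⟩
    refine ⟨N + 1, fun n => ?_⟩
    rw [add_right_comm, hMsucc, hMsucc, hN]
  have hAG : ∀ᵐ ω ∂P, ω ∈ A → θ^[p - 1] ω ∈ G := by
    filter_upwards [hτ_iter, hMle] with ω h1 h2 hω
    refine ⟨p - 1, fun n => ?_⟩
    have hrec : ∀ m k, M (m + (k + 1)) (θ^[k + 1] ω) =
        lossMap (σ (θ^[k] ω)) (τ (θ^[k] ω)) (M (m + k) (θ^[k] ω)) := fun m k => by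
      rw [Function.iterate_succ_apply', ← add_assoc, hMsucc]
    have := lossMap_orbit_coupling (u := fun k => M (n + k) (θ^[k] ω))
      (v := fun k => M (0 + k) (θ^[k] ω)) (fun k => (h1 k).le) (fun k => hMmem _ _)
      (fun k => hMmem _ _) (hrec n) (hrec 0) (fun j => (h2 n j).trans (hA ω hω j))
      (fun j => (h2 0 j).trans (hA ω hω j))
    simpa [add_comm] using this
  have hG : ∀ᵐ ω ∂P, ω ∈ G :=
    hθ.ae_of_forward_invariant hGmeas (ae_of_all _ hGinv) hH.ne' hAG
  classical
  let U : Ω → Fin p → ℝ := fun ω => if h : ω ∈ G then M h.choose ω else 0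
  have hUG : ∀ ω ∈ G, ∃ N, ∀ n, M (N + n) ω = U ω := by
    intro ω h
    refine ⟨h.choose, fun n => ?_⟩
    simp only [U, dif_pos h]
    exact h.choose_spec n
  have hUmem : ∀ ω, U ω ∈ orderedProfiles p := by
    intro ω
    by_cases h : ω ∈ G
    · obtain ⟨N, hN⟩ := hUG ω h
      rw [← hN 0]
      exact hMmem _ _
    · simp only [U, dif_neg h]
      exact zero_mem_orderedProfiles
  have hUmeas : Measurable U := by
    refine measurable_of_tendsto_metrizable (fun n => (hMmeas n).indicator hGmeas)
      (tendsto_pi_nhds.2 fun ω => ?_)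
    by_cases h : ω ∈ G
    · obtain ⟨N, hN⟩ := hUG ω h
      refine tendsto_atTop_of_eventually_const (i₀ := N) fun n hn => ?_
      rw [Set.indicator_of_mem h, ← hN (n - N), Nat.add_sub_cancel' hn]
    · simp only [Set.indicator_of_notMem h, U, dif_neg h]
      exact tendsto_const_nhds
  have hUsol : IsStationarySolution P θ (fun ω => lossMap (σ ω) (τ ω)) U := by
    refine ⟨hUmeas, hUmem, ?_⟩
    filter_upwards [hG] with ω h
    obtain ⟨N, hN⟩ := hUG ω h
    obtain ⟨N', hN'⟩ := hUG (θ ω) (hGinv ω h)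
    have h1 : M (N' + (N + 1)) (θ ω) = lossMap (σ ω) (τ ω) (M (N + N') ω) := by
      rw [← hMsucc]
      congr 1
      omega
    rw [← hN' (N + 1), h1, hN]
  have hUle : ∀ᵐ ω ∂P, U ω ≤ Y ω := hUsol.loss_le_psi hθ hτ_pos hY.1
  refine ⟨U, hUsol, fun U' hU' => ?_, hUle⟩
  have hBmeas : MeasurableSet {ω | U' ω = U ω} := measurableSet_eq_fun hU'.1 hUmeas
  refine hθ.ae_of_forward_invariant hBmeas ?_ hH.ne' (n := p - 1) ?_
  · filter_upwards [hU'.2.2, hUsol.2.2] with ω h1 h2 h3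
    change U' (θ ω) = U (θ ω)
    rw [h1, h2, show U' ω = U ω from h3]
  · filter_upwards [hτ_iter, hUle, hU'.loss_le_psi hθ hτ_pos hY.1,
      ae_forall_iterate hmp hU'.2.2, ae_forall_iterate hmp hUsol.2.2] with ω h1 h2 h3 h4 h5 hω
    refine lossMap_orbit_coupling (u := fun k => U' (θ^[k] ω)) (v := fun k => U (θ^[k] ω))
      (s := fun k => σ (θ^[k] ω)) (fun k => (h1 k).le) (fun k => hU'.2.1 _)
      (fun k => hUmem _) (fun k => ?_) (fun k => ?_) (fun j => (h3 j).trans (hA ω hω j))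
      (fun j => (h2 j).trans (hA ω hω j))
    · rw [Function.iterate_succ_apply', h4]
    · rw [Function.iterate_succ_apply', h5]
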